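/- The function $x \mapsto \dfrac{x^{2}\,\ln(2\cos x)}{\left(x^{2}+\ln^{2}(2\cos x)\right)^{2}}$ is integrable on $[0,\pi/2]$, and $$\int_{0}^{\pi/2} \frac{x^{2}\,\ln(2\cos x)}{\left(x^{2}+\ln^{2}(2\cos x)\right)^{2}}\,dx \;=\; \frac{7\pi}{192}+\frac{\pi\,\ln(2\pi)}{96}-\frac{\zeta'(2)}{16\pi},$$ where $\ln$ is the natural logarithm, $\ln^{2}(y) = (\ln y)^{2}$, and $\zeta'(2)$ is the derivative at $2$ of the Riemann zeta function. -/

import Mathlib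

open Filter Topology Set Asymptotics

/-! For `|x| < π/2`, `1 + e^{2ix} = 2 cos x · e^{ix}`, so `log (1 + z) = ln (2 cos x) + ix` at `z =
e^{2ix}`, and the integrand is `-(x/2) Im (1 / log² (1 + z))` (`integrand_eq`). By evenness and the
scaling `θ = 2x`, the integral becomes the first moment over `[-π, π]` of `Im (1 / log² (1 +
e^{iθ}))`.

Near `0`, `1 / log² (1 + z) = 1/z² + 1/z + 1/12 + z H(z)`, with `H` holomorphic in the disc and
continuous up to its boundary. The explicit terms contribute elementary sine moments. For `z H(z)`,
integration by parts against a primitive of `H` and the mean value property leave `2πi ∫₀¹ H(-t) dt`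
(`integral_id_mul_circle`).

The substitution `t = 1 - e^{-s}` turns this radial integral into minus the Mellin transform at `1`
of `mellinKernel`, a combination of `s⁻² u`, `u² + u³` and `u`, where `u = 1/(e^s - 1)`. For large
real part of the Mellin variable each piece is a product of Gamma and zeta values; analytic
continuation (`mellin_mellinKernel`) carries the formula towards `1`. There the poles of two pieces
cancel, and the functional equation produces `log (2π)` and `ζ'(2)` (`mellin_mellinKernel_one`). -/

/-! ### Regularity of `1 / log² (1 + z)` on the closed disc and its singularity at `0`. -/

/-- The function `1 / log (1 + z) ^ 2`. -/
noncomputable def invLogSq (z : ℂ) : ℂ := 1 / Complex.log (1 + z) ^ 2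

/-- `invLogSq` minus its principal part and constant term at `0`, divided by `z`. -/
noncomputable def invLogSqQuot (z : ℂ) : ℂ :=
  (invLogSq z - 1 / z ^ 2 - 1 / z - 1 / 12) / z

/-- The extension of `invLogSqQuot` over its removable singularity at `0`. -/
noncomputable def invLogSqRem : ℂ → ℂ :=
  Function.update invLogSqQuot 0 (limUnder (𝓝[≠] (0 : ℂ)) invLogSqQuot)

lemma invLogSqRem_of_ne {z : ℂ} (hz : z ≠ 0) : invLogSqRem z = invLogSqQuot z := by
  simp [invLogSqRem, hz]

lemma one_add_mem_slitPlane {z : ℂ} (hz : ‖z‖ ≤ 1) (h1 : z ≠ -1) :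
    1 + z ∈ Complex.slitPlane := by
  left
  have h : -1 ≤ z.re := (abs_le.1 ((Complex.abs_re_le_norm z).trans hz)).1
  rcases h.lt_or_eq with h | h
  · simp; linarith
  · exfalso
    apply h1
    have h2 : z.re ^ 2 + z.im ^ 2 ≤ 1 := by
      have := Complex.sq_norm_sub_sq_re z
      have h3 : ‖z‖ ^ 2 ≤ 1 := pow_le_one₀ (norm_nonneg _) hz
      linarith
    rw [← h] at h2
    have h4 : z.im = 0 := by nlinarith [sq_nonneg z.im]
    apply Complex.ext <;> simp [← h, h4]

lemma log_one_add_ne_zero {z : ℂ} (h0 : z ≠ 0) (h1 : z ≠ -1) : Complex.log (1 + z) ≠ 0 := by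
  intro h
  have h2 : (1 + z) ≠ 0 := fun h => h1 (by linear_combination h)
  have := Complex.exp_log h2
  rw [h, Complex.exp_zero] at this
  exact h0 (by linear_combination -this)

lemma differentiableAt_invLogSq {z : ℂ} (hz : ‖z‖ ≤ 1) (h0 : z ≠ 0) (h1 : z ≠ -1) :
    DifferentiableAt ℂ invLogSq z := by
  unfold invLogSq
  have h2 : DifferentiableAt ℂ (fun z : ℂ => Complex.log (1 + z)) z :=
    ((differentiableAt_const _).add differentiableAt_id).clog (one_add_mem_slitPlane hz h1)
  exact (differentiableAt_const _).div (h2.pow 2) (pow_ne_zero _ (log_one_add_ne_zero h0 h1))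

/-- As `z → -1` the real part `log |1 + z|` tends to `-∞`, so the reciprocal square tends to `0`.
This agrees with the default value at `-1`, where `log 0 = 0` and `1 / 0 = 0`. -/
lemma continuousAt_invLogSq_neg_one : ContinuousAt invLogSq (-1) := by
  rw [continuousAt_iff_punctured_nhds]
  have h0 : invLogSq (-1) = 0 := by simp [invLogSq]
  rw [h0]
  have h1 : Tendsto (fun z : ℂ => ‖1 + z‖) (𝓝[≠] (-1)) (𝓝[≠] 0) := by
    apply tendsto_nhdsWithin_of_tendsto_nhds_of_eventually_within
    · have : ContinuousAt (fun z : ℂ => ‖1 + z‖) (-1) := by fun_prop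
      have h := this.tendsto
      simp only [add_neg_cancel, norm_zero] at h
      exact h.mono_left nhdsWithin_le_nhds
    · filter_upwards [self_mem_nhdsWithin] with z hz
      simp only [mem_compl_iff, mem_singleton_iff, norm_eq_zero]
      intro h
      exact hz (by simp only [mem_singleton_iff]; linear_combination h)
  have h2 := tendsto_abs_atBot_atTop.comp (Real.tendsto_log_nhdsNE_zero.comp h1)
  have h3 : Tendsto (fun z : ℂ => ‖Complex.log (1 + z)‖) (𝓝[≠] (-1)) atTop := by
    refine tendsto_atTop_mono (fun z => ?_) h2
    simp only [Function.comp_apply]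
    rw [← Complex.log_re]
    exact Complex.abs_re_le_norm _
  rw [tendsto_zero_iff_norm_tendsto_zero]
  have h4 := ((tendsto_pow_atTop (two_ne_zero)).comp h3).inv_tendsto_atTop
  refine h4.congr fun z => ?_
  simp [invLogSq]

lemma continuousAt_invLogSq {z : ℂ} (hz : ‖z‖ ≤ 1) (h0 : z ≠ 0) :
    ContinuousAt invLogSq z := by
  by_cases h1 : z = -1
  · rw [h1]; exact continuousAt_invLogSq_neg_one
  · exact (differentiableAt_invLogSq hz h0 h1).continuousAt

lemma tendsto_exp_remainder :
    Tendsto (fun w : ℂ => (Complex.exp w - 1 - w - w ^ 2 / 2 - w ^ 3 / 6) / w ^ 3)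
      (𝓝[≠] 0) (𝓝 0) := by
  rw [tendsto_zero_iff_norm_tendsto_zero]
  have h1 : Tendsto (fun w : ℂ => ‖w‖) (𝓝[≠] 0) (𝓝 0) := by
    have : ContinuousAt (fun w : ℂ => ‖w‖) 0 := by fun_prop
    simpa using this.tendsto.mono_left nhdsWithin_le_nhds
  refine squeeze_zero' (Eventually.of_forall fun _ => norm_nonneg _) ?_ h1
  have h2 : ∀ᶠ w : ℂ in 𝓝[≠] 0, ‖w‖ < 1 := h1.eventually_lt_const one_pos
  filter_upwards [h2, self_mem_nhdsWithin] with w hw hw0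
  have hw0 : w ≠ 0 := hw0
  have h3 := Complex.exp_bound hw.le (n := 4) (by norm_num)
  have h4 : Complex.exp w - ∑ m ∈ Finset.range 4, w ^ m / (m.factorial : ℂ)
      = Complex.exp w - 1 - w - w ^ 2 / 2 - w ^ 3 / 6 := by
    simp [Finset.sum_range_succ, Nat.factorial]; ring
  rw [h4] at h3
  rw [norm_div, norm_pow, div_le_iff₀ (by positivity)]
  refine h3.trans ?_
  have : ‖w‖ * ‖w‖ ^ 3 = ‖w‖ ^ 4 * 1 := by ring
  rw [this]
  gcongr
  norm_num [Nat.factorial]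

/-- This is the constant Laurent coefficient of `1 / log² (1 + z)`, read in the variable `w = log (1
+ z)`. With `e^w - 1 = w d`, the expression is `(d² - 1 - w d) / (w² d²)`, whose numerator is `w²
(1/12 + o(1))`. -/
lemma tendsto_inv_sq_sub_exp :
    Tendsto (fun w : ℂ => 1 / w ^ 2 - 1 / (Complex.exp w - 1) ^ 2 - 1 / (Complex.exp w - 1))
      (𝓝[≠] 0) (𝓝 (1 / 12)) := by
  have hr := tendsto_exp_remainder
  set r : ℂ → ℂ := fun w => (Complex.exp w - 1 - w - w ^ 2 / 2 - w ^ 3 / 6) / w ^ 3 with hrdef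
  have hw : Tendsto (fun w : ℂ => w) (𝓝[≠] 0) (𝓝 0) := tendsto_id.mono_left nhdsWithin_le_nhds
  have hden : Tendsto (fun w => 1 + w / 2 + w ^ 2 * (1 / 6 + r w)) (𝓝[≠] 0) (𝓝 1) := by
    have := (tendsto_const_nhds (x := (1 : ℂ))).add (hw.div_const 2) |>.add
      ((hw.pow 2).mul ((tendsto_const_nhds (x := (1 / 6 : ℂ))).add hr))
    simpa using this
  have hnum : Tendsto (fun w => 1 / 12 + 2 * r w + w ^ 2 * (1 / 6 + r w) ^ 2) (𝓝[≠] 0)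
      (𝓝 (1 / 12)) := by
    have := (tendsto_const_nhds (x := (1 / 12 : ℂ))).add (hr.const_mul 2) |>.add
      ((hw.pow 2).mul (((tendsto_const_nhds (x := (1 / 6 : ℂ))).add hr).pow 2))
    simpa using this
  have hq := hnum.div (hden.pow 2) (by norm_num)
  simp only [one_pow, div_one] at hq
  refine hq.congr' ?_
  filter_upwards [self_mem_nhdsWithin, hden.eventually_ne one_ne_zero] with w hw0 hd
  have hw0 : w ≠ 0 := hw0
  have hexp : Complex.exp w = 1 + w * (1 + w / 2 + w ^ 2 * (1 / 6 + r w)) := by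
    simp only [hrdef]; field_simp; ring
  simp only [Pi.div_apply]
  rw [hexp]
  set ρ := r w
  have h2 : 1 + w * (1 + w / 2 + w ^ 2 * (1 / 6 + ρ)) - 1
    = w * (1 + w / 2 + w ^ 2 * (1 / 6 + ρ)) := by ring
  rw [h2]
  obtain ⟨d, hdd⟩ : ∃ d, d = 1 + w / 2 + w ^ 2 * (1 / 6 + ρ) := ⟨_, rfl⟩
  rw [← hdd] at hd ⊢
  rw [div_eq_iff (pow_ne_zero _ hd)]
  field_simp
  rw [hdd]
  ring

lemma tendsto_log_one_add : Tendsto (fun z : ℂ => Complex.log (1 + z)) (𝓝[≠] 0) (𝓝[≠] 0) := by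
  apply tendsto_nhdsWithin_of_tendsto_nhds_of_eventually_within
  · have : ContinuousAt (fun z : ℂ => Complex.log (1 + z)) 0 := by
      apply ContinuousAt.clog (by fun_prop)
      simp
    simpa using this.tendsto.mono_left nhdsWithin_le_nhds
  · have h : ∀ᶠ z : ℂ in 𝓝[≠] 0, z ≠ -1 :=
      (tendsto_id.mono_left nhdsWithin_le_nhds).eventually_ne (by norm_num)
    filter_upwards [self_mem_nhdsWithin, h] with z hz h1
    exact log_one_add_ne_zero hz h1

lemma tendsto_invLogSq_sub :
    Tendsto (fun z : ℂ => invLogSq z - 1 / z ^ 2 - 1 / z - 1 / 12) (𝓝[≠] 0) (𝓝 0) := by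
  have h := (tendsto_inv_sq_sub_exp.comp tendsto_log_one_add).sub_const (1 / 12)
  rw [sub_self] at h
  refine h.congr' ?_
  have h : ∀ᶠ z : ℂ in 𝓝[≠] 0, z ≠ -1 :=
    (tendsto_id.mono_left nhdsWithin_le_nhds).eventually_ne (by norm_num)
  filter_upwards [h] with z h1
  have h2 : (1 + z) ≠ 0 := fun h => h1 (by linear_combination h)
  simp [invLogSq, Complex.exp_log h2]

/-- Riemann's removable singularity theorem in its little-o form: `z` times the quotient tends to
`0`, so the coefficient of `z` in the expansion is never needed. -/
lemma differentiableOn_invLogSqRem : DifferentiableOn ℂ invLogSqRem (Metric.ball 0 1) := by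
  apply Complex.differentiableOn_update_limUnder_of_isLittleO
    (Metric.ball_mem_nhds _ one_pos)
  · intro z hz
    have hz1 : ‖z‖ < 1 := by simpa using hz.1
    have hz0 : z ≠ 0 := hz.2
    have h1 : z ≠ -1 := by rintro rfl; simp at hz1
    apply DifferentiableAt.differentiableWithinAt
    unfold invLogSqQuot
    have := differentiableAt_invLogSq hz1.le hz0 h1
    have hz2 : z ^ 2 ≠ 0 := pow_ne_zero _ hz0
    fun_prop (disch := assumption)
  · have h0 : invLogSqQuot 0 = 0 := by simp [invLogSqQuot]
    simp only [h0, sub_zero]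
    rw [Asymptotics.isLittleO_iff_tendsto']
    · refine tendsto_invLogSq_sub.congr' ?_
      filter_upwards [self_mem_nhdsWithin] with z hz
      have hz : z ≠ 0 := hz
      simp [invLogSqQuot, hz]
    · filter_upwards [self_mem_nhdsWithin] with z hz h
      exact absurd (inv_eq_zero.1 h) hz

lemma continuousOn_invLogSqRem : ContinuousOn invLogSqRem (Metric.closedBall 0 1) := by
  intro z hz
  apply ContinuousAt.continuousWithinAt
  have hz1 : ‖z‖ ≤ 1 := by simpa using hz
  by_cases hz0 : z = 0
  · rw [hz0]
    exact (differentiableOn_invLogSqRem.differentiableAt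
      (Metric.ball_mem_nhds _ one_pos)).continuousAt
  · have h : invLogSqRem =ᶠ[𝓝 z] invLogSqQuot := by
      filter_upwards [isOpen_ne.mem_nhds hz0] with y hy using invLogSqRem_of_ne hy
    refine ContinuousAt.congr ?_ h.symm
    unfold invLogSqQuot
    have := continuousAt_invLogSq hz1 hz0
    have hz2 : z ^ 2 ≠ 0 := pow_ne_zero _ hz0
    fun_prop (disch := assumption)

/-! ### First angular moments of holomorphic functions on circles. -/

lemma mem_ball_of_scaled_exp {r : ℝ} (h0 : 0 ≤ r) (h1 : r < 1) (θ : ℝ) :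
    (r : ℂ) * Complex.exp (θ * Complex.I) ∈ Metric.ball (0 : ℂ) 1 := by
  simp [Complex.norm_exp_ofReal_mul_I, abs_of_nonneg h0, h1]

lemma hasDerivAt_scaled_exp (r θ : ℝ) :
    HasDerivAt (fun θ : ℝ => (r : ℂ) * Complex.exp (θ * Complex.I))
      (r * (Complex.exp (θ * Complex.I) * Complex.I)) θ := by
  have h : HasDerivAt (fun z : ℂ => (r : ℂ) * Complex.exp (z * Complex.I))
      (r * (Complex.exp (θ * Complex.I) * Complex.I)) (θ : ℂ) := by
    have := (((hasDerivAt_id (θ : ℂ)).mul_const Complex.I).cexp).const_mul (r : ℂ)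
    simpa using this
  exact h.comp_ofReal

lemma integral_circle_of_differentiableOn_ball {K : ℂ → ℂ}
    (hK : DifferentiableOn ℂ K (Metric.ball 0 1)) {r : ℝ} (h0 : 0 ≤ r) (h1 : r < 1) :
    ∫ θ in (-Real.pi)..Real.pi, K (r * Complex.exp (θ * Complex.I)) = 2 * Real.pi * K 0 := by
  have hd : DiffContOnCl ℂ K (Metric.ball 0 |r|) := by
    apply DifferentiableOn.diffContOnCl
    refine hK.mono (Metric.closure_ball_subset_closedBall.trans ?_)
    exact Metric.closedBall_subset_ball (by rwa [abs_of_nonneg h0])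
  have hav := hd.circleAverage
  have hper := (periodic_circleMap 0 r).comp K |>.intervalIntegral_add_eq (-Real.pi) 0
  have e1 : -Real.pi + 2 * Real.pi = Real.pi := by ring
  rw [e1, zero_add] at hper
  rw [Real.circleAverage_def] at hav
  have hpi : (Real.pi : ℂ) ≠ 0 := by exact_mod_cast Real.pi_ne_zero
  simp only [Function.comp_apply] at hper
  rw [← hper] at hav
  simp only [circleMap, zero_add] at hav
  rw [← hav, Complex.real_smul]
  push_cast
  rw [mul_inv_cancel_left₀ (by simp)]

/-- Let `K` be a primitive of `H`. Integrating `θ` by parts against `d/dθ K(r e^{iθ})` gives the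
boundary term `2π K(-r)` minus the circle integral `2π K(0)`, and `K(-r) - K(0)` is an integral of
`H` along the negative radius. -/
lemma integral_id_mul_circle_of_lt {H : ℂ → ℂ} (hH : DifferentiableOn ℂ H (Metric.ball 0 1))
    {r : ℝ} (h0 : 0 ≤ r) (h1 : r < 1) :
    ∫ θ in (-Real.pi)..Real.pi, (θ : ℂ) * (r * Complex.exp (θ * Complex.I) *
        H (r * Complex.exp (θ * Complex.I)))
      = 2 * Real.pi * Complex.I * ∫ t in (0 : ℝ)..1, (r : ℂ) * H (-(r * t)) := by
  obtain ⟨K, hK⟩ := hH.isExactOn_ball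
  have hKd : DifferentiableOn ℂ K (Metric.ball 0 1) := fun z hz =>
    (hK z hz).differentiableAt.differentiableWithinAt
  have hcirc := integral_circle_of_differentiableOn_ball hKd h0 h1
  have hderiv : ∀ θ : ℝ, HasDerivAt (fun θ : ℝ => K (r * Complex.exp (θ * Complex.I)))
      (H (r * Complex.exp (θ * Complex.I)) * (r * (Complex.exp (θ * Complex.I) * Complex.I))) θ :=
    fun θ => (hK _ (mem_ball_of_scaled_exp h0 h1 θ)).comp θ (hasDerivAt_scaled_exp r θ)
  have hHc : Continuous fun θ : ℝ => H (r * Complex.exp (θ * Complex.I)) :=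
    hH.continuousOn.comp_continuous (by fun_prop) (mem_ball_of_scaled_exp h0 h1)
  have hparts := intervalIntegral.integral_mul_deriv_eq_deriv_mul
    (a := -Real.pi) (b := Real.pi) (u := fun θ : ℝ => (θ : ℂ)) (u' := fun _ => 1)
    (fun θ _ => (hasDerivAt_id θ).ofReal_comp) (fun θ _ => hderiv θ)
    (by apply Continuous.intervalIntegrable; fun_prop)
    (by apply Continuous.intervalIntegrable; exact hHc.mul (by fun_prop))
  have hmem : ∀ t ∈ uIcc (0 : ℝ) 1, -((r : ℂ) * t) ∈ Metric.ball (0 : ℂ) 1 := by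
    intro t ht
    rw [uIcc_of_le zero_le_one] at ht
    simp only [Metric.mem_ball, dist_zero_right, norm_neg, norm_mul, Complex.norm_real,
      Real.norm_eq_abs, abs_of_nonneg h0, abs_of_nonneg ht.1]
    nlinarith [ht.1, ht.2]
  have hray : ∫ t in (0 : ℝ)..1, H (-(r * t)) * (-(r : ℂ)) = K (-r) - K 0 := by
    have := intervalIntegral.integral_eq_sub_of_hasDerivAt (a := 0) (b := 1)
      (f := fun t : ℝ => K (-((r : ℂ) * t))) (f' := fun t : ℝ => H (-(r * t)) * (-(r : ℂ))) ?_ ?_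
    · rw [this]; simp
    · intro t ht
      refine (hK _ (hmem t ht)).comp t ?_
      have h : HasDerivAt (fun z : ℂ => -((r : ℂ) * z)) (-(r : ℂ)) (t : ℂ) := by
        simpa using ((hasDerivAt_id (t : ℂ)).const_mul (r : ℂ)).fun_neg
      exact h.comp_ofReal
    · apply ContinuousOn.intervalIntegrable
      refine ContinuousOn.mul (hH.continuousOn.comp (by fun_prop) hmem) continuousOn_const
  have e1 : (r : ℂ) * Complex.exp ((Real.pi : ℝ) * Complex.I) = -r := by
    rw [Complex.exp_pi_mul_I]; ring
  have e2 : (r : ℂ) * Complex.exp (((-Real.pi : ℝ) : ℂ) * Complex.I) = -r := by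
    push_cast
    rw [neg_mul, Complex.exp_neg, Complex.exp_pi_mul_I]; ring
  simp only [one_mul, e1, e2, hcirc] at hparts
  have e3 : ∀ θ : ℝ, (θ : ℂ) * (r * Complex.exp (θ * Complex.I) *
        H (r * Complex.exp (θ * Complex.I))) = -Complex.I * ((θ : ℂ) *
      (H (r * Complex.exp (θ * Complex.I)) * (r * (Complex.exp (θ * Complex.I) * Complex.I)))) := by
    intro θ
    linear_combination ((θ : ℂ) * (r * Complex.exp (θ * Complex.I) *
        H (r * Complex.exp (θ * Complex.I)))) * Complex.I_mul_I
  have e4 : ∀ t : ℝ, (r : ℂ) * H (-(r * t)) = - (H (-(r * t)) * (-(r : ℂ))) := fun t => by ring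
  simp only [e3, e4]
  rw [intervalIntegral.integral_const_mul, hparts, intervalIntegral.integral_neg, hray]
  push_cast
  ring

/-- For `H` holomorphic on the open unit disc and continuous up to the boundary, the first moment
in the angle of `z * H z` along the unit circle is an integral of `H` along the negative radius. -/
lemma integral_id_mul_circle {H : ℂ → ℂ} (hH : DifferentiableOn ℂ H (Metric.ball 0 1))
    (hc : ContinuousOn H (Metric.closedBall 0 1)) :
    ∫ θ in (-Real.pi)..Real.pi, (θ : ℂ) * (Complex.exp (θ * Complex.I) *
        H (Complex.exp (θ * Complex.I)))
      = 2 * Real.pi * Complex.I * ∫ t in (0 : ℝ)..1, H (-t) := by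
  -- Clamping to `[0, 1]` keeps every argument of `H` in the closed disc, so both sides are
  -- continuous in `r` on all of `ℝ`; equality on `(0, 1)` then passes to `r = 1`.
  set c : ℝ → ℝ := fun r => max 0 (min r 1) with hcdef
  have hcc : Continuous c := by fun_prop
  have hc0 : ∀ r, 0 ≤ c r := fun r => le_max_left _ _
  have hc1 : ∀ r, c r ≤ 1 := fun r => max_le zero_le_one (min_le_right _ _)
  have hcid : ∀ r ∈ Icc (0 : ℝ) 1, c r = r := fun r hr => by
    simp [hcdef, hr.1, hr.2]
  have hL : Continuous fun r : ℝ => ∫ θ in (-Real.pi)..Real.pi,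
      (θ : ℂ) * (c r * Complex.exp (θ * Complex.I) * H (c r * Complex.exp (θ * Complex.I))) := by
    apply intervalIntegral.continuous_parametric_intervalIntegral_of_continuous'
    have : Continuous fun p : ℝ × ℝ => H (c p.1 * Complex.exp (p.2 * Complex.I)) := by
      refine hc.comp_continuous (by fun_prop) fun p => ?_
      simp [Complex.norm_exp_ofReal_mul_I, abs_of_nonneg (hc0 p.1), hc1 p.1]
    exact Continuous.mul (by fun_prop) (Continuous.mul (by fun_prop) this)
  have hR : Continuous fun r : ℝ => 2 * Real.pi * Complex.I *
      ∫ t in (0 : ℝ)..1, (c r : ℂ) * H (-(c r * c t)) := by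
    refine continuous_const.mul ?_
    apply intervalIntegral.continuous_parametric_intervalIntegral_of_continuous'
    have : Continuous fun p : ℝ × ℝ => H (-(c p.1 * c p.2)) := by
      refine hc.comp_continuous (by fun_prop) fun p => ?_
      simp only [Metric.mem_closedBall, dist_zero_right, norm_neg, norm_mul, Complex.norm_real,
        Real.norm_eq_abs, abs_of_nonneg (hc0 p.1), abs_of_nonneg (hc0 p.2)]
      exact mul_le_one₀ (hc1 _) (hc0 _) (hc1 _)
    exact Continuous.mul (by fun_prop) this
  have hEq := Set.EqOn.closure (s := Ioo (0 : ℝ) 1) (fun r hr => ?_) hL hR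
  · rw [closure_Ioo zero_ne_one] at hEq
    have h1 := hEq (right_mem_Icc.2 zero_le_one)
    simp only [hcid 1 (right_mem_Icc.2 zero_le_one), Complex.ofReal_one, one_mul] at h1
    rw [h1]
    congr 1
    apply intervalIntegral.integral_congr
    intro t ht
    rw [uIcc_of_le zero_le_one] at ht
    simp only [hcid t ht]
  · simp only [hcid r (Ioo_subset_Icc_self hr)]
    rw [integral_id_mul_circle_of_lt hH hr.1.le hr.2]
    congr 1
    apply intervalIntegral.integral_congr
    intro t ht
    rw [uIcc_of_le zero_le_one] at ht
    simp only [hcid t ht]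

/-! ### Mellin transforms of powers of `1 / (e^t - 1)`. -/

/-- The function `1 / (exp t - 1)`. -/
noncomputable def expSubOneInv (t : ℝ) : ℝ := (Real.exp t - 1)⁻¹

lemma expSubOneInv_pos {t : ℝ} (ht : 0 < t) : 0 < expSubOneInv t := by
  unfold expSubOneInv
  have := Real.add_one_lt_exp ht.ne'
  exact inv_pos.2 (by linarith)

lemma expSubOneInv_le_inv {t : ℝ} (ht : 0 < t) : expSubOneInv t ≤ t⁻¹ := by
  unfold expSubOneInv
  exact inv_anti₀ ht (by linarith [Real.add_one_le_exp t])

lemma expSubOneInv_le_exp_neg {t : ℝ} (ht : 1 ≤ t) : expSubOneInv t ≤ 2 * Real.exp (-t) := by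
  unfold expSubOneInv
  have h := Real.add_one_le_exp t
  rw [Real.exp_neg, ← div_eq_mul_inv, inv_eq_one_div, div_le_div_iff₀ (by linarith) (by linarith)]
  linarith

lemma continuousOn_expSubOneInv : ContinuousOn expSubOneInv (Ioi 0) := by
  unfold expSubOneInv
  apply ContinuousOn.inv₀ (by fun_prop)
  intro t ht
  have := Real.add_one_lt_exp (ne_of_gt (show (0 : ℝ) < t from ht))
  have ht : (0 : ℝ) < t := ht
  linarith

lemma expSubOneInv_eq_exp_neg {t : ℝ} (ht : 0 < t) :
    expSubOneInv t = Real.exp (-t) / (1 - Real.exp (-t)) := by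
  unfold expSubOneInv
  have h1 : Real.exp t - 1 ≠ 0 := by linarith [Real.add_one_lt_exp ht.ne']
  rw [Real.exp_neg]
  field_simp

lemma isBigO_expSubOneInv_pow_top {k : ℕ} (hk : k ≠ 0) :
    (fun t => (((expSubOneInv t) ^ k : ℝ) : ℂ)) =O[atTop] fun t => Real.exp (-1 * t) := by
  refine IsBigO.of_bound 2 ?_
  filter_upwards [eventually_ge_atTop 1] with t ht
  have h0 := expSubOneInv_pos (lt_of_lt_of_le one_pos ht)
  have h1 := expSubOneInv_le_inv (lt_of_lt_of_le one_pos ht)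
  have h2 : expSubOneInv t ≤ 1 := h1.trans (inv_le_one_of_one_le₀ ht)
  rw [Complex.norm_real, Real.norm_of_nonneg (by positivity), Real.norm_of_nonneg (by positivity),
    neg_one_mul]
  exact (pow_le_of_le_one h0.le h2 hk).trans (expSubOneInv_le_exp_neg ht)

lemma isBigO_expSubOneInv_pow_zero (k : ℕ) :
    (fun t => (((expSubOneInv t) ^ k : ℝ) : ℂ)) =O[𝓝[>] 0] (· ^ (-(k : ℝ)) : ℝ → ℝ) := by
  refine IsBigO.of_bound 1 ?_
  filter_upwards [self_mem_nhdsWithin] with t ht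
  have ht : 0 < t := ht
  have h0 := expSubOneInv_pos ht
  rw [Complex.norm_real, Real.norm_of_nonneg (by positivity), Real.norm_of_nonneg (by positivity),
    one_mul, Real.rpow_neg ht.le, Real.rpow_natCast, ← inv_pow]
  exact pow_le_pow_left₀ h0.le (expSubOneInv_le_inv ht) k

lemma mellinConvergent_expSubOneInv_pow {k : ℕ} (hk : k ≠ 0) {s : ℂ} (hs : k < s.re) :
    MellinConvergent (fun t => (((expSubOneInv t) ^ k : ℝ) : ℂ)) s := by
  refine mellinConvergent_of_isBigO_rpow_exp one_pos ?_ (isBigO_expSubOneInv_pow_top hk)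
    (isBigO_expSubOneInv_pow_zero k) hs
  exact (Complex.continuous_ofReal.comp_continuousOn
    (continuousOn_expSubOneInv.pow k)).locallyIntegrableOn measurableSet_Ioi

lemma hasSum_riemannZeta_add_one {s : ℂ} (hs : 1 < s.re) :
    HasSum (fun n : ℕ => 1 / ((n : ℂ) + 1) ^ s) (riemannZeta s) := by
  rw [zeta_eq_tsum_one_div_nat_add_one_cpow hs]
  apply Summable.hasSum
  have := (summable_nat_add_iff 1).2 (Complex.summable_one_div_nat_cpow.2 hs)
  simpa using this

lemma summable_rpow_add_one {s : ℝ} (hs : 1 < s) :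
    Summable fun n : ℕ => 1 / ((n : ℝ) + 1) ^ s := by
  have := (summable_nat_add_iff 1).2 (Real.summable_one_div_nat_rpow.2 hs)
  simpa using this

lemma cexp_pow_eq (t : ℝ) (n : ℕ) :
    ((Real.exp (-((n : ℝ) + 1) * t) : ℝ) : ℂ) = ((Real.exp (-t) : ℝ) : ℂ) ^ (n + 1) := by
  rw [← Complex.ofReal_pow, ← Real.exp_nat_mul]
  congr 2
  push_cast
  ring

lemma exp_neg_lt_one_of_pos {t : ℝ} (ht : 0 < t) : Real.exp (-t) < 1 := by
  simpa using ht

lemma norm_exp_neg_lt_one {t : ℝ} (ht : 0 < t) : ‖((Real.exp (-t) : ℝ) : ℂ)‖ < 1 := by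
  rw [Complex.norm_real, Real.norm_of_nonneg (by positivity)]
  exact exp_neg_lt_one_of_pos ht

lemma mellin_expSubOneInv {s : ℂ} (hs : 1 < s.re) :
    mellin (fun t => (expSubOneInv t : ℂ)) s = Complex.Gamma s * riemannZeta s := by
  have h := hasSum_mellin (ι := ℕ) (a := fun _ => 1) (p := fun n => (n : ℝ) + 1)
    (F := fun t => (expSubOneInv t : ℂ)) (s := s) (fun n => Or.inr (by positivity))
    (by linarith) ?_ ?_
  · refine h.unique ?_
    have := (hasSum_riemannZeta_add_one hs).mul_left (Complex.Gamma s)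
    convert! this using 2 with n
    push_cast
    ring
  · intro t ht
    have ht : 0 < t := ht
    simp only [cexp_pow_eq, one_mul]
    have h1 := (hasSum_geometric_of_norm_lt_one (norm_exp_neg_lt_one ht)).mul_left
      ((Real.exp (-t) : ℝ) : ℂ)
    rw [expSubOneInv_eq_exp_neg ht]
    rw [Complex.ofReal_div, div_eq_mul_inv, Complex.ofReal_sub, Complex.ofReal_one]
    convert! h1 using 2 with n
    ring
  · simpa using summable_rpow_add_one hs

/-- With `q = e^{-t}` and `u = q / (1 - q)`, `u² + u³ = q² / (1 - q)³ = ∑ C(m, 2) q^m`, and `C(m, 2)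
= (m² - m) / 2` splits the Dirichlet series into two shifted zeta values. -/
lemma mellin_expSubOneInv_sq_add_cube {s : ℂ} (hs : 3 < s.re) :
    mellin (fun t => (((expSubOneInv t) ^ 2 : ℝ) : ℂ) + (((expSubOneInv t) ^ 3 : ℝ) : ℂ)) s
      = Complex.Gamma s * ((riemannZeta (s - 2) - riemannZeta (s - 1)) / 2) := by
  have hchoose : ∀ n : ℕ, (((n + 1).choose 2 : ℕ) : ℝ) = ((n : ℝ) + 1) * n / 2 := fun n => by
    rw [Nat.cast_choose_two]; push_cast; ring
  have h := hasSum_mellin (ι := ℕ) (a := fun n => (((n + 1).choose 2 : ℕ) : ℂ))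
    (p := fun n => (n : ℝ) + 1)
    (F := fun t => (((expSubOneInv t) ^ 2 : ℝ) : ℂ) + (((expSubOneInv t) ^ 3 : ℝ) : ℂ))
    (s := s) (fun n => Or.inr (by positivity)) (by linarith) ?_ ?_
  · refine h.unique ?_
    have h1 := hasSum_riemannZeta_add_one (s := s - 2) (by simp; linarith)
    have h2 := hasSum_riemannZeta_add_one (s := s - 1) (by simp; linarith)
    have := ((h1.sub h2).div_const 2).mul_left (Complex.Gamma s)
    convert! this using 2 with n
    have hn : (n : ℂ) + 1 ≠ 0 := by exact_mod_cast n.succ_ne_zero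
    have hc : (((n + 1).choose 2 : ℕ) : ℂ) = ((n : ℂ) + 1) * n / 2 := by
      rw [Nat.cast_choose_two]; push_cast; ring
    have hp : ((n : ℂ) + 1) ^ s ≠ 0 := by simp [Complex.cpow_eq_zero_iff, hn]
    rw [hc, Complex.cpow_sub _ _ hn, Complex.cpow_sub _ _ hn, Complex.cpow_one,
      Complex.cpow_ofNat]
    push_cast
    field_simp
    ring
  · intro t ht
    have ht : 0 < t := ht
    simp only [cexp_pow_eq]
    have h1 := (hasSum_choose_mul_geometric_of_norm_lt_one 2 (norm_exp_neg_lt_one ht)).mul_left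
      (((Real.exp (-t) : ℝ) : ℂ) ^ 2)
    -- The `n = 0` term has coefficient `C(1, 2) = 0`; dropping it aligns the series with the
    -- binomial series for `(1 - q)⁻³`.
    rw [← hasSum_nat_add_iff' 1]
    simp only [expSubOneInv_eq_exp_neg ht]
    have hval : (((Real.exp (-t) / (1 - Real.exp (-t))) ^ 2 : ℝ) : ℂ)
        + (((Real.exp (-t) / (1 - Real.exp (-t))) ^ 3 : ℝ) : ℂ)
        - ∑ i ∈ Finset.range 1, (((i + 1).choose 2 : ℕ) : ℂ) * ((Real.exp (-t) : ℝ) : ℂ) ^ (i + 1)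
        = ((Real.exp (-t) : ℝ) : ℂ) ^ 2 * (1 / (1 - ((Real.exp (-t) : ℝ) : ℂ)) ^ (2 + 1)) := by
      have : 1 - Real.exp (-t) ≠ 0 := by
        have : Real.exp (-t) < 1 := exp_neg_lt_one_of_pos ht
        linarith
      have h3 : (1 : ℂ) - (Real.exp (-t) : ℝ) ≠ 0 := by exact_mod_cast this
      push_cast at h3 ⊢
      simp only [Finset.range_one, Finset.sum_singleton, zero_add, Nat.choose_eq_zero_of_lt one_lt_two,
        Nat.cast_zero, zero_mul, sub_zero]
      field_simp
      ring
    rw [hval]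
    convert! h1 using 2 with n
    ring
  · refine Summable.of_nonneg_of_le (fun n => by positivity) (fun n => ?_)
      (summable_rpow_add_one (s := s.re - 2) (by linarith))
    have hn : (0 : ℝ) < (n : ℝ) + 1 := by positivity
    rw [Complex.norm_natCast, hchoose, Real.rpow_sub hn, one_div_div]
    gcongr
    rw [Real.rpow_ofNat]
    nlinarith [hn]

/-! ### The Mellin transform of the kernel and its continuation. -/

/-- The function whose Mellin transform is evaluated at `1`. -/
noncomputable def mellinKernel (t : ℝ) : ℂ :=
  ((t : ℂ) ^ (-2 : ℂ) * (expSubOneInv t : ℂ)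
    - ((((expSubOneInv t) ^ 2 : ℝ) : ℂ) + (((expSubOneInv t) ^ 3 : ℝ) : ℂ)))
    - (1 / 12 : ℂ) * (expSubOneInv t : ℂ)

lemma mellin_mellinKernel_of_three_lt {s : ℂ} (hs : 3 < s.re) :
    mellin mellinKernel s = Complex.Gamma (s - 2) * riemannZeta (s - 2)
      - Complex.Gamma s * ((riemannZeta (s - 2) - riemannZeta (s - 1)) / 2)
      - 1 / 12 * (Complex.Gamma s * riemannZeta s) := by
  have c1 : ∀ {s : ℂ}, 1 < s.re → MellinConvergent (fun t => (expSubOneInv t : ℂ)) s := by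
    intro s hs
    simpa using mellinConvergent_expSubOneInv_pow one_ne_zero (s := s) (by simpa using hs)
  have hs2 : 1 < (s + -2).re := by simp; linarith
  have A : HasMellin (fun t : ℝ => (t : ℂ) ^ (-2 : ℂ) • (expSubOneInv t : ℂ)) s
      (Complex.Gamma (s - 2) * riemannZeta (s - 2)) :=
    ⟨MellinConvergent.cpow_smul.2 (c1 hs2), by
      rw [mellin_cpow_smul, mellin_expSubOneInv hs2, sub_eq_add_neg]⟩
  have B : MellinConvergent
      (fun t => (((expSubOneInv t) ^ 2 : ℝ) : ℂ) + (((expSubOneInv t) ^ 3 : ℝ) : ℂ)) s :=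
    (hasMellin_add (mellinConvergent_expSubOneInv_pow two_ne_zero (by norm_num; linarith))
      (mellinConvergent_expSubOneInv_pow three_ne_zero (by norm_num; linarith))).1
  have C := hasMellin_const_smul (c1 (s := s) (by linarith)) (1 / 12 : ℂ)
  have D := hasMellin_sub A.1 B
  have E := hasMellin_sub D.1 C.1
  have := E.2
  rw [D.2, C.2, A.2, mellin_expSubOneInv_sq_add_cube hs, mellin_expSubOneInv (by linarith)] at this
  simp only [smul_eq_mul] at this
  exact this

/-- At `z = e^{-t} - 1`, `log (1 + z) = -t`. With `u = 1 / (e^t - 1)`, `-e^{-t} / z = u` and `1/z² +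
1/z = u + u²`. The cancellation of singularities at `t = 0` is thus inherited from the removable
singularity at `z = 0`. -/
lemma mellinKernel_eq {t : ℝ} (ht : 0 < t) :
    mellinKernel t = -(Real.exp (-t) : ℂ) * invLogSqRem ((Real.exp (-t) : ℂ) - 1) := by
  have hq : Real.exp (-t) < 1 := exp_neg_lt_one_of_pos ht
  have hq0 : ((Real.exp (-t) : ℝ) : ℂ) - 1 ≠ 0 := by
    have : Real.exp (-t) - 1 ≠ 0 := by linarith
    exact_mod_cast this
  have hlog : Complex.log (1 + ((Real.exp (-t) : ℂ) - 1)) = -t := by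
    rw [add_sub_cancel, ← Complex.ofReal_log (Real.exp_pos _).le, Real.log_exp]
    push_cast; rfl
  rw [invLogSqRem_of_ne hq0, invLogSqQuot, invLogSq, hlog, mellinKernel,
    expSubOneInv_eq_exp_neg ht, Complex.cpow_neg, Complex.cpow_ofNat]
  have ht' : (t : ℂ) ≠ 0 := by exact_mod_cast ht.ne'
  have h1 : 1 - ((Real.exp (-t) : ℝ) : ℂ) ≠ 0 := fun h => hq0 (by linear_combination -h)
  push_cast at hq0 h1 ⊢
  obtain ⟨d, hd⟩ : ∃ d : ℂ, d = 1 - Complex.exp (-t) := ⟨_, rfl⟩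
  have e1 : Complex.exp (-t) = 1 - d := by rw [hd]; ring
  rw [e1] at h1 ⊢
  have e2 : 1 - d - 1 = -d := by ring
  have e3 : 1 - (1 - d) = d := by ring
  rw [e3] at h1
  rw [e2, e3]
  field_simp
  ring

lemma continuousOn_mellinKernel : ContinuousOn mellinKernel (Ioi 0) := by
  have h : ContinuousOn (fun t : ℝ =>
      -(Real.exp (-t) : ℂ) * invLogSqRem ((Real.exp (-t) : ℂ) - 1)) (Ioi 0) := by
    refine ContinuousOn.mul (by fun_prop)
      (differentiableOn_invLogSqRem.continuousOn.comp (by fun_prop) ?_)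
    intro t ht
    have h0 : Real.exp (-t) < 1 := exp_neg_lt_one_of_pos ht
    have h1 := Real.exp_pos (-t)
    show (Real.exp (-t) : ℂ) - 1 ∈ _
    rw [mem_ball_zero_iff, ← Complex.ofReal_one, ← Complex.ofReal_sub, Complex.norm_real,
      Real.norm_eq_abs, abs_lt]
    constructor <;> linarith
  exact h.congr fun t ht => mellinKernel_eq ht

lemma isBigO_mellinKernel_zero : mellinKernel =O[𝓝[>] 0] (· ^ (-0 : ℝ) : ℝ → ℝ) := by
  have h : Tendsto mellinKernel (𝓝[>] 0) (𝓝 (-(1 : ℂ) * invLogSqRem 0)) := by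
    have hc : ContinuousAt (fun t : ℝ =>
        -(Real.exp (-t) : ℂ) * invLogSqRem ((Real.exp (-t) : ℂ) - 1)) 0 := by
      refine ContinuousAt.mul (by fun_prop) (ContinuousAt.comp_of_eq (y := 0) ?_ (by fun_prop)
        (by simp))
      exact (differentiableOn_invLogSqRem.differentiableAt
        (Metric.ball_mem_nhds _ one_pos)).continuousAt
    have h1 := hc.tendsto.mono_left (nhdsWithin_le_nhds (s := Ioi 0))
    simp only [neg_zero, Real.exp_zero, Complex.ofReal_one, sub_self] at h1
    refine h1.congr' ?_
    filter_upwards [self_mem_nhdsWithin] with t ht using (mellinKernel_eq ht).symm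
  simpa using h.isBigO_one ℝ

lemma isBigO_mellinKernel_top : mellinKernel =O[atTop] fun t => Real.exp (-1 * t) := by
  have h1 : (fun t => (expSubOneInv t : ℂ)) =O[atTop] fun t => Real.exp (-1 * t) := by
    simpa using isBigO_expSubOneInv_pow_top one_ne_zero
  have h2 : (fun t : ℝ => (t : ℂ) ^ (-2 : ℂ)) =O[atTop] fun _ => (1 : ℝ) := by
    refine IsBigO.of_bound 1 ?_
    filter_upwards [eventually_ge_atTop 1] with t ht
    rw [Complex.norm_cpow_eq_rpow_re_of_pos (by linarith)]
    simpa using Real.rpow_le_one_of_one_le_of_nonpos ht (by norm_num : (-2 : ℝ) ≤ 0)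
  have h3 := h2.mul h1
  simp only [one_mul] at h3
  exact (h3.sub ((isBigO_expSubOneInv_pow_top two_ne_zero).add
    (isBigO_expSubOneInv_pow_top three_ne_zero))).sub (h1.const_mul_left _)

lemma differentiableAt_mellin_mellinKernel {s : ℂ} (hs : 0 < s.re) :
    DifferentiableAt ℂ (mellin mellinKernel) s :=
  mellin_differentiableAt_of_isBigO_rpow_exp one_pos
    (continuousOn_mellinKernel.locallyIntegrableOn measurableSet_Ioi) isBigO_mellinKernel_top
    isBigO_mellinKernel_zero hs

lemma differentiableAt_Gamma_of_im_pos {s : ℂ} (hs : 0 < s.im) :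
    DifferentiableAt ℂ Complex.Gamma s := by
  apply Complex.differentiableAt_Gamma
  rintro m rfl
  simp at hs

lemma differentiableAt_riemannZeta_of_im_pos {s : ℂ} (hs : 0 < s.im) :
    DifferentiableAt ℂ riemannZeta s := by
  apply differentiableAt_riemannZeta
  rintro rfl
  simp at hs

/-- Identity theorem from the region `Re s > 3`. All poles of the Gamma and zeta factors are real,
so the open first quadrant avoids them and, being convex, is connected. -/
lemma mellin_mellinKernel {s : ℂ} (hs : 0 < s.re) (hs' : 0 < s.im) :
    mellin mellinKernel s = Complex.Gamma (s - 2) * riemannZeta (s - 2)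
      - Complex.Gamma s * ((riemannZeta (s - 2) - riemannZeta (s - 1)) / 2)
      - 1 / 12 * (Complex.Gamma s * riemannZeta s) := by
  set U : Set ℂ := {s | 0 < s.re} ∩ {s | 0 < s.im} with hU
  have hUo : IsOpen U := (isOpen_lt continuous_const Complex.continuous_re).inter
    (isOpen_lt continuous_const Complex.continuous_im)
  have hUc : IsPreconnected U :=
    ((convex_halfSpace_re_gt 0).inter (convex_halfSpace_im_gt 0)).isPreconnected
  have hf : AnalyticOnNhd ℂ (mellin mellinKernel) U :=
    DifferentiableOn.analyticOnNhd (fun s hs =>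
      (differentiableAt_mellin_mellinKernel hs.1).differentiableWithinAt) hUo
  have hg : AnalyticOnNhd ℂ (fun s => Complex.Gamma (s - 2) * riemannZeta (s - 2)
      - Complex.Gamma s * ((riemannZeta (s - 2) - riemannZeta (s - 1)) / 2)
      - 1 / 12 * (Complex.Gamma s * riemannZeta s)) U := by
    refine DifferentiableOn.analyticOnNhd (fun s hs => ?_) hUo
    have him : 0 < s.im := hs.2
    apply DifferentiableAt.differentiableWithinAt
    have sub : ∀ a : ℂ, DifferentiableAt ℂ (fun s : ℂ => s - a) s := fun a => by fun_prop
    have g0 := differentiableAt_Gamma_of_im_pos him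
    have g2 : DifferentiableAt ℂ (fun s => Complex.Gamma (s - 2)) s :=
      (differentiableAt_Gamma_of_im_pos (s := s - 2) (by simpa using him)).comp s (sub 2)
    have z0 := differentiableAt_riemannZeta_of_im_pos him
    have z1 : DifferentiableAt ℂ (fun s => riemannZeta (s - 1)) s :=
      (differentiableAt_riemannZeta_of_im_pos (s := s - 1) (by simpa using him)).comp s (sub 1)
    have z2 : DifferentiableAt ℂ (fun s => riemannZeta (s - 2)) s :=
      (differentiableAt_riemannZeta_of_im_pos (s := s - 2) (by simpa using him)).comp s (sub 2)
    exact ((g2.mul z2).sub (g0.mul ((z2.sub z1).div_const 2))).sub ((g0.mul z0).const_mul _)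
  have h0 : (4 + Complex.I) ∈ U := by constructor <;> simp
  refine hf.eqOn_of_preconnected_of_eventuallyEq hg hUc h0 ?_ ⟨hs, hs'⟩
  have : ∀ᶠ s : ℂ in 𝓝 (4 + Complex.I), 3 < s.re :=
    (isOpen_lt continuous_const Complex.continuous_re).mem_nhds (by simp; norm_num)
  filter_upwards [this] with s hs using mellin_mellinKernel_of_three_lt hs

/-! ### Laurent expansions at `s = 1` and the value of the Mellin transform there. -/

lemma tendsto_const_mul_punctured {a : ℂ} (ha : a ≠ 0) :
    Tendsto (fun u : ℂ => a * u) (𝓝[≠] 0) (𝓝[≠] 0) := by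
  apply tendsto_nhdsWithin_of_tendsto_nhds_of_eventually_within
  · have : ContinuousAt (fun u : ℂ => a * u) 0 := by fun_prop
    simpa using this.tendsto.mono_left nhdsWithin_le_nhds
  · filter_upwards [self_mem_nhdsWithin] with u hu
    exact mul_ne_zero ha hu

lemma tendsto_sin_sub_div_sq :
    Tendsto (fun u : ℂ => (Complex.sin u - u) / u ^ 2) (𝓝[≠] 0) (𝓝 0) := by
  have h1 := tendsto_exp_remainder.comp (tendsto_const_mul_punctured Complex.I_ne_zero)
  have h2 := tendsto_exp_remainder.comp (tendsto_const_mul_punctured (neg_ne_zero.2 Complex.I_ne_zero))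
  have hu : Tendsto (fun u : ℂ => u) (𝓝[≠] 0) (𝓝 0) := tendsto_id.mono_left nhdsWithin_le_nhds
  have h := (hu.neg.div_const 2).mul (((tendsto_const_nhds (x := (1 / 3 : ℂ))).add h1).add h2)
  simp only [neg_zero, zero_div, zero_mul] at h
  refine h.congr' ?_
  filter_upwards [self_mem_nhdsWithin] with u hu
  have hu : u ≠ 0 := hu
  have e1 : (Complex.I * u) ^ 2 = -u ^ 2 := by rw [mul_pow, Complex.I_sq]; ring
  have e2 : (-Complex.I * u) ^ 2 = -u ^ 2 := by rw [mul_pow, neg_sq, Complex.I_sq]; ring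
  have e3 : (Complex.I * u) ^ 3 = -Complex.I * u ^ 3 := by rw [mul_pow, Complex.I_pow_three]
  have e4 : (-Complex.I * u) ^ 3 = Complex.I * u ^ 3 := by
    rw [mul_pow, Odd.neg_pow (by decide), Complex.I_pow_three]; ring
  simp only [Function.comp_apply, e1, e2, e3, e4, Complex.sin]
  have hI := Complex.I_ne_zero
  rw [show u * Complex.I = Complex.I * u from mul_comm _ _,
    show -u * Complex.I = -Complex.I * u by ring]
  field_simp
  linear_combination
    36 * (Complex.exp (u * Complex.I) - Complex.exp (-(u * Complex.I))) * Complex.I_sq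

lemma tendsto_div_sin : Tendsto (fun u : ℂ => u / Complex.sin u) (𝓝[≠] 0) (𝓝 1) := by
  have h := (hasDerivAt_iff_tendsto_slope.1 (Complex.hasDerivAt_sin 0)).inv₀ (by simp)
  rw [Complex.cos_zero, inv_one] at h
  refine h.congr fun u => ?_
  simp [slope_def_field]

lemma tendsto_inv_sin_sub_inv :
    Tendsto (fun u : ℂ => 1 / Complex.sin u - 1 / u) (𝓝[≠] 0) (𝓝 0) := by
  have h := (tendsto_sin_sub_div_sq.mul tendsto_div_sin).neg
  simp only [zero_mul, neg_zero] at h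
  refine h.congr' ?_
  filter_upwards [self_mem_nhdsWithin, tendsto_div_sin.eventually_ne one_ne_zero] with u hu hs
  have hu : u ≠ 0 := hu
  have hs : Complex.sin u ≠ 0 := fun h => hs (by rw [h, div_zero])
  field_simp
  ring

/-- The functional equation at `2 - ε` is combined with the reflection formula for Gamma; the
double-angle formula cancels the cosine. The bounds on `ε` keep the sine and cosine nonzero. -/
lemma Gamma_mul_riemannZeta_sub_one {ε : ℂ} (hε : ‖ε‖ < 1) (h0 : ε ≠ 0) :
    Complex.Gamma (ε - 1) * riemannZeta (ε - 1) =
      Real.pi * (2 * Real.pi : ℂ) ^ (ε - 2) * riemannZeta (2 - ε)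
        / Complex.sin (Real.pi / 2 * ε) := by
  have hre : |ε.re| < 1 := (Complex.abs_re_le_norm _).trans_lt hε
  have hre1 := (abs_lt.1 hre)
  have hs : ∀ n : ℕ, (2 - ε) ≠ -n := by
    intro n h
    have := congrArg Complex.re h
    simp at this
    have : (0 : ℝ) ≤ n := n.cast_nonneg
    linarith
  have hs1 : (2 - ε) ≠ 1 := by
    intro h
    have := congrArg Complex.re h
    simp at this
    linarith
  have hfe := riemannZeta_one_sub hs hs1
  have hrefl := Complex.Gamma_mul_Gamma_one_sub (2 - ε)
  have e1 : 1 - (2 - ε) = ε - 1 := by ring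
  have e2 : -(2 - ε) = ε - 2 := by ring
  have e3 : (Real.pi : ℂ) * (2 - ε) = 2 * (Real.pi * (2 - ε) / 2) := by ring
  have e4 : (Real.pi : ℂ) * (2 - ε) / 2 = Real.pi - Real.pi / 2 * ε := by ring
  rw [e1, e2] at hfe
  rw [e1, e3, Complex.sin_two_mul] at hrefl
  rw [e4, Complex.cos_pi_sub] at hfe
  rw [e4, Complex.sin_pi_sub, Complex.cos_pi_sub] at hrefl
  have hc : Complex.cos (Real.pi / 2 * ε) ≠ 0 := by
    rw [Complex.cos_ne_zero_iff]
    intro k hk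
    have hpi : (Real.pi : ℂ) ≠ 0 := by exact_mod_cast Real.pi_ne_zero
    have h : ε = 2 * k + 1 := by
      field_simp at hk
      exact hk
    have h' := congrArg Complex.re h
    simp at h'
    rw [h'] at hre
    rw [abs_lt] at hre
    have h3 : -1 < 2 * k + 1 := by
      have : (-1 : ℝ) < ((2 * k + 1 : ℤ) : ℝ) := by push_cast; exact hre.1
      exact_mod_cast this
    have h4 : 2 * k + 1 < 1 := by
      have : ((2 * k + 1 : ℤ) : ℝ) < 1 := by push_cast; exact hre.2
      exact_mod_cast this
    omega
  have hsn : Complex.sin (Real.pi / 2 * ε) ≠ 0 := by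
    rw [Complex.sin_ne_zero_iff]
    intro k hk
    have hpi : (Real.pi : ℂ) ≠ 0 := by exact_mod_cast Real.pi_ne_zero
    have h : ε = 2 * k := by
      field_simp at hk
      linear_combination hk
    have h' := congrArg Complex.re h
    simp at h'
    rw [h'] at hre
    rw [abs_lt] at hre
    have h3 : -1 < 2 * k := by
      have : (-1 : ℝ) < ((2 * k : ℤ) : ℝ) := by push_cast; exact hre.1
      exact_mod_cast this
    have h4 : 2 * k < 1 := by
      have : ((2 * k : ℤ) : ℝ) < 1 := by push_cast; exact hre.2
      exact_mod_cast this
    have : k = 0 := by omega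
    exact h0 (by simp [h, this])
  rw [hfe, eq_div_iff hsn]
  have h5 : Complex.Gamma (2 - ε) * Complex.Gamma (ε - 1) * (2 * Complex.sin (Real.pi / 2 * ε) *
      -Complex.cos (Real.pi / 2 * ε)) = Real.pi := by
    rw [hrefl]
    apply div_mul_cancel₀
    simp [hsn, hc]
  linear_combination (2 * Real.pi : ℂ) ^ (ε - 2) * riemannZeta (2 - ε) * h5

lemma tendsto_Gamma_mul_riemannZeta_sub_one :
    Tendsto (fun ε : ℂ => Complex.Gamma (ε - 1) * riemannZeta (ε - 1) - 1 / (12 * ε)) (𝓝[≠] 0)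
      (𝓝 (Complex.log (2 * Real.pi) / 12 - deriv riemannZeta 2 / (2 * Real.pi ^ 2))) := by
  have hpi : (Real.pi : ℂ) ≠ 0 := by exact_mod_cast Real.pi_ne_zero
  set P : ℂ → ℂ := fun ε => Real.pi * (2 * Real.pi : ℂ) ^ (ε - 2) * riemannZeta (2 - ε) with hP
  have hP0 : P 0 = Real.pi / 24 := by
    simp only [hP, zero_sub, sub_zero, riemannZeta_two, Complex.cpow_neg, Complex.cpow_ofNat]
    field_simp
    norm_num
  have hPd : HasDerivAt P (Real.pi / 24 * Complex.log (2 * Real.pi)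
      - deriv riemannZeta 2 / (4 * Real.pi)) 0 := by
    have h1 : HasDerivAt (fun ε : ℂ => (2 * Real.pi : ℂ) ^ (ε - 2))
        ((2 * Real.pi : ℂ) ^ ((0 : ℂ) - 2) * Complex.log (2 * Real.pi) * 1) 0 :=
      ((hasDerivAt_id (0 : ℂ)).sub_const 2).const_cpow (Or.inl (by simp [hpi]))
    have h2 : HasDerivAt (fun ε : ℂ => riemannZeta (2 - ε)) (deriv riemannZeta 2 * (-1)) 0 := by
      have hz : HasDerivAt riemannZeta (deriv riemannZeta 2) (2 - 0) := by
        rw [sub_zero]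
        exact (differentiableAt_riemannZeta (by norm_num)).hasDerivAt
      exact hz.comp (0 : ℂ) ((hasDerivAt_id (0 : ℂ)).const_sub 2)
    have h3 := (h1.const_mul (Real.pi : ℂ)).mul h2
    refine h3.congr_deriv ?_
    simp only [zero_sub, sub_zero, riemannZeta_two, Complex.cpow_neg, Complex.cpow_ofNat]
    field_simp
    ring
  have hhalf : (Real.pi : ℂ) / 2 ≠ 0 := by simp [hpi]
  have hslope := hasDerivAt_iff_tendsto_slope.1 hPd
  have hsin := (tendsto_div_sin.comp (tendsto_const_mul_punctured hhalf)).const_mul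
    (2 / (Real.pi : ℂ))
  have hinv := (tendsto_inv_sin_sub_inv.comp (tendsto_const_mul_punctured hhalf)).const_mul (P 0)
  -- With `P` the numerator, `P(ε) / sin` is split as `(P(ε) - P(0)) / sin + P(0) / sin`. The first
  -- part tends to `P'(0) · 2/π`; the second is `1 / (12 ε)` up to `o(1)`, since `1 / sin u - 1 / u
  -- → 0`.
  have h := (hslope.mul hsin).add hinv
  have hval : (Real.pi / 24 * Complex.log (2 * Real.pi) - deriv riemannZeta 2 / (4 * Real.pi))
      * (2 / (Real.pi : ℂ) * 1) + P 0 * 0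
      = Complex.log (2 * Real.pi) / 12 - deriv riemannZeta 2 / (2 * Real.pi ^ 2) := by
    field_simp
    ring
  rw [hval] at h
  refine h.congr' ?_
  have hball : ∀ᶠ ε : ℂ in 𝓝[≠] 0, ‖ε‖ < 1 := by
    have := Metric.ball_mem_nhds (0 : ℂ) one_pos
    filter_upwards [nhdsWithin_le_nhds this] with ε hε using by simpa using hε
  filter_upwards [self_mem_nhdsWithin, hball] with ε h0 h1
  have h0 : ε ≠ 0 := h0
  rw [Gamma_mul_riemannZeta_sub_one h1 h0]
  have : Real.pi * (2 * Real.pi : ℂ) ^ (ε - 2) * riemannZeta (2 - ε) = P ε := rfl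
  rw [this]
  simp only [Function.comp_apply, slope_def_field, sub_zero]
  have hPpi : 1 / (12 * ε) = P 0 * (1 / (Real.pi / 2 * ε)) := by
    rw [hP0]; field_simp; norm_num
  rw [hPpi]
  field_simp
  ring

/-- The constant terms cancel: `ζ(1 + ε) - 1/ε` tends to Euler's constant and `Γ'(1)` is its
negative. -/
lemma tendsto_Gamma_mul_riemannZeta_one_add :
    Tendsto (fun ε : ℂ => Complex.Gamma (1 + ε) * riemannZeta (1 + ε) - 1 / ε) (𝓝[≠] 0) (𝓝 0) := by
  have hshift : Tendsto (fun ε : ℂ => 1 + ε) (𝓝[≠] 0) (𝓝[≠] 1) := by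
    apply tendsto_nhdsWithin_of_tendsto_nhds_of_eventually_within
    · have : ContinuousAt (fun u : ℂ => 1 + u) 0 := by fun_prop
      simpa using this.tendsto.mono_left nhdsWithin_le_nhds
    · filter_upwards [self_mem_nhdsWithin] with u hu
      simpa using hu
  have h1 := tendsto_riemannZeta_sub_one_div.comp hshift
  have h2 := (hasDerivAt_iff_tendsto_slope.1 Complex.hasDerivAt_Gamma_one).comp hshift
  have h3 := (Complex.hasDerivAt_Gamma_one.continuousAt.tendsto.mono_left
    (nhdsWithin_le_nhds (s := {1}ᶜ))).comp hshift
  have h := (h3.mul h1).add h2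
  rw [Complex.Gamma_one, one_mul, add_neg_cancel] at h
  refine h.congr' ?_
  filter_upwards [self_mem_nhdsWithin] with ε h0
  have h0 : ε ≠ 0 := h0
  simp only [Function.comp_apply, slope_def_field, Complex.Gamma_one, add_sub_cancel_left]
  field_simp
  ring

lemma mellin_mellinKernel_one :
    mellin mellinKernel 1 =
      -5 / 24 + Complex.log (2 * Real.pi) / 12 - deriv riemannZeta 2 / (2 * Real.pi ^ 2) := by
  have hmid : Tendsto (fun ε : ℂ => Complex.Gamma (1 + ε) *
      ((riemannZeta (ε - 1) - riemannZeta ε) / 2)) (𝓝[≠] 0) (𝓝 (5 / 24)) := by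
    have hc : ContinuousAt (fun ε : ℂ => Complex.Gamma (1 + ε) *
      ((riemannZeta (ε - 1) - riemannZeta ε) / 2)) 0 := by
      have g : ContinuousAt (fun ε : ℂ => Complex.Gamma (1 + ε)) 0 :=
        ContinuousAt.comp_of_eq Complex.hasDerivAt_Gamma_one.continuousAt (by fun_prop) (by simp)
      have z1 : ContinuousAt (fun ε : ℂ => riemannZeta (ε - 1)) 0 :=
        ContinuousAt.comp_of_eq (differentiableAt_riemannZeta (s := -1) (by norm_num)).continuousAt
          (by fun_prop) (by simp)
      have z0 := (differentiableAt_riemannZeta (s := 0) (by norm_num)).continuousAt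
      exact g.mul ((z1.sub z0).div_const 2)
    have h := hc.tendsto.mono_left (nhdsWithin_le_nhds (s := {0}ᶜ))
    have hz : riemannZeta (-1) = -1 / 12 := by
      have := riemannZeta_neg_nat_eq_bernoulli' 1
      norm_num [bernoulli'_two] at this
      rw [this]; norm_num
    convert h using 2
    rw [add_zero, Complex.Gamma_one, zero_sub, hz, riemannZeta_zero]
    norm_num
  have hlim := (tendsto_Gamma_mul_riemannZeta_sub_one.sub hmid).sub
    (tendsto_Gamma_mul_riemannZeta_one_add.const_mul (1 / 12))
  -- The point `1` is approached vertically from inside the quadrant where the closed form is known.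
  have hpath : Tendsto (fun y : ℝ => (y : ℂ) * Complex.I) (𝓝[>] 0) (𝓝[≠] 0) := by
    apply tendsto_nhdsWithin_of_tendsto_nhds_of_eventually_within
    · have : ContinuousAt (fun y : ℝ => (y : ℂ) * Complex.I) 0 := by fun_prop
      simpa using this.tendsto.mono_left nhdsWithin_le_nhds
    · filter_upwards [self_mem_nhdsWithin] with y hy
      have hy : (0 : ℝ) < y := hy
      simp [hy.ne']
  have hM : Tendsto (fun y : ℝ => mellin mellinKernel (1 + y * Complex.I)) (𝓝[>] 0)
      (𝓝 (mellin mellinKernel 1)) := by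
    have hc : ContinuousAt (fun y : ℝ => mellin mellinKernel (1 + y * Complex.I)) 0 :=
      ContinuousAt.comp_of_eq (g := mellin mellinKernel)
        (f := fun y : ℝ => 1 + (y : ℂ) * Complex.I) (y := 1)
        (differentiableAt_mellin_mellinKernel (s := 1) (by simp)).continuousAt
        (by fun_prop) (by simp)
    have h := hc.tendsto.mono_left (nhdsWithin_le_nhds (s := Ioi 0))
    simpa using h
  have hR := hlim.comp hpath
  have key := tendsto_nhds_unique hM (hR.congr' ?_)
  · rw [key]; ring
  · filter_upwards [self_mem_nhdsWithin] with y hy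
    have hy : (0 : ℝ) < y := hy
    rw [mellin_mellinKernel (by simp) (by simpa using hy)]
    simp only [Function.comp_apply]
    have e1 : 1 + (y : ℂ) * Complex.I - 2 = y * Complex.I - 1 := by ring
    have e2 : 1 + (y : ℂ) * Complex.I - 1 = y * Complex.I := by ring
    have hy0 : (y : ℂ) ≠ 0 := by exact_mod_cast hy.ne'
    have hI := Complex.I_ne_zero
    rw [e1, e2]
    field_simp
    ring

/-! ### Reduction of the real integral to the Mellin value. -/

lemma integral_invLogSqRem_neg :
    ∫ t in (0 : ℝ)..1, invLogSqRem (-t) = -mellin mellinKernel 1 := by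
  have himg : (fun s : ℝ => 1 - Real.exp (-s)) '' Ioi 0 = Ioo 0 1 := by
    ext t
    constructor
    · rintro ⟨s, hs, rfl⟩
      have h := exp_neg_lt_one_of_pos (show (0 : ℝ) < s from hs)
      have h' := Real.exp_pos (-s)
      constructor <;> simp only <;> linarith
    · rintro ⟨h0, h1⟩
      refine ⟨-Real.log (1 - t), ?_, ?_⟩
      · simpa using Real.log_neg (by linarith) (by linarith)
      · simp only [neg_neg]
        rw [Real.exp_log (by linarith)]; ring
  have hinj : InjOn (fun s : ℝ => 1 - Real.exp (-s)) (Ioi 0) := by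
    intro a _ b _ h
    simpa using h
  have hder : ∀ s ∈ Ioi (0 : ℝ),
      HasDerivWithinAt (fun s : ℝ => 1 - Real.exp (-s)) (Real.exp (-s)) (Ioi 0) s := by
    intro s _
    have := ((hasDerivAt_neg s).exp.const_sub 1)
    simpa using this.hasDerivWithinAt
  have h := MeasureTheory.integral_image_eq_integral_abs_deriv_smul measurableSet_Ioi hder hinj
    (fun t : ℝ => invLogSqRem (-t))
  rw [intervalIntegral.integral_of_le zero_le_one, MeasureTheory.integral_Ioc_eq_integral_Ioo,
    ← himg, h, mellin, ← MeasureTheory.integral_neg]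
  apply MeasureTheory.setIntegral_congr_fun measurableSet_Ioi
  intro s hs
  have hs : (0 : ℝ) < s := hs
  simp only [sub_self, Complex.cpow_zero, one_smul, abs_of_pos (Real.exp_pos _),
    mellinKernel_eq hs, Complex.real_smul]
  push_cast
  rw [neg_sub, neg_mul, neg_neg]

lemma log_one_add_exp {x : ℝ} (h1 : -(Real.pi / 2) < x) (h2 : x < Real.pi / 2) :
    Complex.log (1 + Complex.exp ((2 * x : ℝ) * Complex.I))
      = Real.log (2 * Real.cos x) + x * Complex.I := by
  have hc := Real.cos_pos_of_mem_Ioo ⟨h1, h2⟩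
  have e : 1 + Complex.exp ((2 * x : ℝ) * Complex.I)
      = Complex.exp (Real.log (2 * Real.cos x) + x * Complex.I) := by
    rw [Complex.exp_add, ← Complex.ofReal_exp, Real.exp_log (by positivity)]
    push_cast
    rw [Complex.cos, mul_div_cancel₀ _ two_ne_zero, add_mul, ← Complex.exp_add, ← Complex.exp_add,
      neg_mul, neg_add_cancel, Complex.exp_zero, add_comm]
    ring_nf
  rw [e, Complex.log_exp] <;> simp <;> linarith

lemma integrand_eq_of_lt {x : ℝ} (h1 : -(Real.pi / 2) < x) (h2 : x < Real.pi / 2) :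
    x ^ 2 * Real.log (2 * Real.cos x) / (x ^ 2 + Real.log (2 * Real.cos x) ^ 2) ^ 2
      = -(x / 2) * (invLogSq (Complex.exp ((2 * x : ℝ) * Complex.I))).im := by
  rw [invLogSq, log_one_add_exp h1 h2]
  set l := Real.log (2 * Real.cos x)
  have e : ((l : ℂ) + x * Complex.I) ^ 2 = ((l ^ 2 - x ^ 2 : ℝ) : ℂ) + ((2 * l * x : ℝ) : ℂ) * Complex.I := by
    push_cast
    linear_combination (x : ℂ) ^ 2 * Complex.I_sq
  rw [e, one_div, Complex.inv_im, Complex.normSq_add_mul_I]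
  have e2 : (l ^ 2 - x ^ 2) ^ 2 + (2 * l * x) ^ 2 = (x ^ 2 + l ^ 2) ^ 2 := by ring
  have e3 : (((l ^ 2 - x ^ 2 : ℝ) : ℂ) + ((2 * l * x : ℝ) : ℂ) * Complex.I).im = 2 * l * x := by
    rw [Complex.add_im, Complex.ofReal_im, Complex.im_ofReal_mul, Complex.I_im]; ring
  rw [e2, e3]
  ring

/-- The integrand in terms of the imaginary part of `invLogSq` on the unit circle. -/
lemma integrand_eq {x : ℝ} (h1 : -(Real.pi / 2) ≤ x) (h2 : x ≤ Real.pi / 2) :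
    x ^ 2 * Real.log (2 * Real.cos x) / (x ^ 2 + Real.log (2 * Real.cos x) ^ 2) ^ 2
      = -(x / 2) * (invLogSq (Complex.exp ((2 * x : ℝ) * Complex.I))).im := by
  -- At `x = ±π/2` both sides vanish by the convention `log 0 = 0`.
  have h0 : invLogSq (-1) = 0 := by simp [invLogSq]
  rcases h1.eq_or_lt with h1 | h1
  · have e : Complex.exp ((2 * x : ℝ) * Complex.I) = -1 := by
      rw [← h1, show 2 * -(Real.pi / 2) = -Real.pi by ring, Complex.ofReal_neg, neg_mul,
        Complex.exp_neg, Complex.exp_pi_mul_I]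
      norm_num
    rw [e, h0, ← h1]
    simp
  rcases h2.eq_or_lt with h2 | h2
  · have e : Complex.exp ((2 * x : ℝ) * Complex.I) = -1 := by
      rw [h2, show 2 * (Real.pi / 2) = Real.pi by ring, Complex.exp_pi_mul_I]
    rw [e, h0, h2]
    simp
  exact integrand_eq_of_lt h1 h2

lemma continuous_invLogSq_circle :
    Continuous fun θ : ℝ => invLogSq (Complex.exp (θ * Complex.I)) := by
  rw [continuous_iff_continuousAt]
  intro θ
  refine ContinuousAt.comp (g := invLogSq) ?_ (by fun_prop)
  exact continuousAt_invLogSq (Complex.norm_exp_ofReal_mul_I θ).le (Complex.exp_ne_zero _)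

lemma integral_id_mul_sin (n : ℕ) (hn : n ≠ 0) :
    ∫ θ in (-Real.pi)..Real.pi, θ * Real.sin (n * θ) = -(2 * Real.pi * (-1) ^ n / n) := by
  have hn' : (n : ℝ) ≠ 0 := by exact_mod_cast hn
  have h := intervalIntegral.integral_eq_sub_of_hasDerivAt (a := -Real.pi) (b := Real.pi)
    (f := fun θ : ℝ => -(θ * Real.cos (n * θ) / n) + Real.sin (n * θ) / n ^ 2)
    (f' := fun θ : ℝ => θ * Real.sin (n * θ)) ?_ ?_
  · rw [h]
    simp only [mul_neg, Real.cos_neg, Real.sin_neg, Real.cos_nat_mul_pi, Real.sin_nat_mul_pi]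
    ring
  · intro θ _
    have hl : HasDerivAt (fun θ : ℝ => (n : ℝ) * θ) n θ := by
      simpa using (hasDerivAt_id θ).const_mul (n : ℝ)
    have h1 := (((hasDerivAt_id θ).mul hl.cos).div_const (n : ℝ)).neg
    have h2 := hl.sin.div_const ((n : ℝ) ^ 2)
    refine (h1.add h2).congr_deriv ?_
    simp only [id]
    field_simp
    ring
  · apply Continuous.intervalIntegrable; fun_prop

/-- On the circle `1/z` and `1/z²` have imaginary parts `-sin θ` and `-sin 2θ`, with first moments
`-2π` and `π`; together they give the term `-π`. The real constant `1/12` contributes nothing. -/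
lemma integral_id_mul_im_invLogSq :
    ∫ θ in (-Real.pi)..Real.pi, θ * (invLogSq (Complex.exp (θ * Complex.I))).im
      = -(2 * Real.pi * (mellin mellinKernel 1).re) - Real.pi := by
  have hcirc := integral_id_mul_circle differentiableOn_invLogSqRem continuousOn_invLogSqRem
  rw [integral_invLogSqRem_neg] at hcirc
  have hcont : Continuous fun θ : ℝ => (θ : ℂ) * (Complex.exp (θ * Complex.I) *
      invLogSqRem (Complex.exp (θ * Complex.I))) := by
    have : Continuous fun θ : ℝ => invLogSqRem (Complex.exp (θ * Complex.I)) :=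
      continuousOn_invLogSqRem.comp_continuous (by fun_prop)
        (fun θ => by simp [Complex.norm_exp_ofReal_mul_I])
    exact Continuous.mul (by fun_prop) (Continuous.mul (by fun_prop) this)
  have him := (Complex.imCLM.intervalIntegral_comp_comm
    (hcont.intervalIntegrable (μ := MeasureTheory.volume) (-Real.pi) Real.pi))
  rw [hcirc] at him
  have hpt : ∀ θ : ℝ, θ * (invLogSq (Complex.exp (θ * Complex.I))).im
      = Complex.imCLM ((θ : ℂ) * (Complex.exp (θ * Complex.I) *
        invLogSqRem (Complex.exp (θ * Complex.I))))
        - θ * Real.sin ((1 : ℕ) * θ) - θ * Real.sin ((2 : ℕ) * θ) := by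
    intro θ
    have hz := Complex.exp_ne_zero ((θ : ℂ) * Complex.I)
    have e1 : 1 / Complex.exp (θ * Complex.I) = Complex.exp (((-θ : ℝ) : ℂ) * Complex.I) := by
      rw [one_div, ← Complex.exp_neg]; push_cast; rw [neg_mul]
    have e2 : 1 / Complex.exp (θ * Complex.I) ^ 2
        = Complex.exp (((-(2 * θ) : ℝ) : ℂ) * Complex.I) := by
      rw [one_div, ← Complex.exp_nat_mul, ← Complex.exp_neg]; push_cast; congr 1; ring
    rw [invLogSqRem_of_ne hz, invLogSqQuot, mul_div_cancel₀ _ hz, e1, e2, Complex.imCLM_apply,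
      Complex.im_ofReal_mul]
    have e3 : (1 / 12 : ℂ).im = 0 := by
      rw [show (1 / 12 : ℂ) = ((1 / 12 : ℝ) : ℂ) by push_cast; rfl, Complex.ofReal_im]
    simp only [Complex.sub_im, e3, Complex.exp_ofReal_mul_I_im, Real.sin_neg]
    push_cast
    ring_nf
  simp only [hpt]
  rw [intervalIntegral.integral_sub, intervalIntegral.integral_sub, him,
    integral_id_mul_sin 1 one_ne_zero, integral_id_mul_sin 2 two_ne_zero]
  · simp
    ring
  · exact (Complex.imCLM.continuous.comp hcont).intervalIntegrable _ _
  · apply Continuous.intervalIntegrable; fun_prop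
  · apply Continuous.intervalIntegrable
    exact (Complex.imCLM.continuous.comp hcont).sub (by fun_prop)
  · apply Continuous.intervalIntegrable; fun_prop

/-- The kernel is real-valued on the positive axis, so the complex closed form may replace the real
part that comes out of the circle integral. -/
lemma ofReal_re_mellin_mellinKernel_one :
    (((mellin mellinKernel 1).re : ℝ) : ℂ) = mellin mellinKernel 1 := by
  have h : mellin mellinKernel 1 = ((∫ t in Ioi (0 : ℝ), ((t ^ 2)⁻¹ * expSubOneInv t
      - (expSubOneInv t ^ 2 + expSubOneInv t ^ 3) - 1 / 12 * expSubOneInv t) : ℝ) : ℂ) := by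
    rw [← integral_complex_ofReal, mellin]
    refine MeasureTheory.setIntegral_congr_fun measurableSet_Ioi fun t _ => ?_
    simp only [mellinKernel, sub_self, Complex.cpow_zero, one_smul, Complex.cpow_neg,
      Complex.cpow_ofNat]
    push_cast
    rfl
  rw [h, Complex.ofReal_re]

theorem mainTheorem4 :
    IntervalIntegrable
      (fun x : ℝ => x ^ 2 * Real.log (2 * Real.cos x) /
        (x ^ 2 + Real.log (2 * Real.cos x) ^ 2) ^ 2)
      MeasureTheory.volume 0 (Real.pi / 2) ∧
    ((∫ x in (0 : ℝ)..(Real.pi / 2),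
        x ^ 2 * Real.log (2 * Real.cos x) /
          (x ^ 2 + Real.log (2 * Real.cos x) ^ 2) ^ 2 : ℝ) : ℂ) =
      7 * (Real.pi : ℂ) / 192 + ((Real.pi * Real.log (2 * Real.pi) / 96 : ℝ) : ℂ)
        - deriv riemannZeta 2 / (16 * (Real.pi : ℂ)) := by
  set f : ℝ → ℝ := fun x => x ^ 2 * Real.log (2 * Real.cos x) /
    (x ^ 2 + Real.log (2 * Real.cos x) ^ 2) ^ 2 with hf
  have hpi := Real.pi_pos
  -- Continuity, endpoints included, comes from that of `invLogSq` on the unit circle and yields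
  -- integrability.
  have hcont : ContinuousOn f (Icc (-(Real.pi / 2)) (Real.pi / 2)) := by
    have h : Continuous fun x : ℝ =>
        -(x / 2) * (invLogSq (Complex.exp ((2 * x : ℝ) * Complex.I))).im :=
      Continuous.mul (by fun_prop) (Complex.continuous_im.comp
        (continuous_invLogSq_circle.comp (continuous_const.mul continuous_id)))
    exact h.continuousOn.congr fun x hx => integrand_eq hx.1 hx.2
  have hint : ∀ a ∈ Icc (-(Real.pi / 2)) (Real.pi / 2), ∀ b ∈ Icc (-(Real.pi / 2)) (Real.pi / 2),
      IntervalIntegrable f MeasureTheory.volume a b := fun a ha b hb =>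
    (hcont.mono (ordConnected_Icc.uIcc_subset ha hb)).intervalIntegrable
  have hm : -(Real.pi / 2) ∈ Icc (-(Real.pi / 2)) (Real.pi / 2) := ⟨le_rfl, by linarith⟩
  have h0 : (0 : ℝ) ∈ Icc (-(Real.pi / 2)) (Real.pi / 2) := ⟨by linarith, by linarith⟩
  have hp : Real.pi / 2 ∈ Icc (-(Real.pi / 2)) (Real.pi / 2) := ⟨by linarith, le_rfl⟩
  refine ⟨hint 0 h0 _ hp, ?_⟩
  have heven : ∫ x in (-(Real.pi / 2))..0, f x = ∫ x in (0 : ℝ)..(Real.pi / 2), f x := by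
    have h := intervalIntegral.integral_comp_neg (a := 0) (b := Real.pi / 2) f
    rw [neg_zero] at h
    rw [← h]
    apply intervalIntegral.integral_congr
    intro x _
    simp [hf]
  have hsplit := intervalIntegral.integral_add_adjacent_intervals (hint _ hm 0 h0) (hint 0 h0 _ hp)
  rw [heven] at hsplit
  have hscale := intervalIntegral.integral_comp_mul_left (a := -(Real.pi / 2)) (b := Real.pi / 2)
    (fun θ => θ * (invLogSq (Complex.exp (θ * Complex.I))).im) (two_ne_zero (α := ℝ))
  rw [show (2 : ℝ) * -(Real.pi / 2) = -Real.pi by ring,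
    show (2 : ℝ) * (Real.pi / 2) = Real.pi by ring, integral_id_mul_im_invLogSq] at hscale
  have hf4 : ∫ x in (-(Real.pi / 2))..(Real.pi / 2),
      2 * x * (invLogSq (Complex.exp ((2 * x : ℝ) * Complex.I))).im
      = ∫ x in (-(Real.pi / 2))..(Real.pi / 2), -4 * f x := by
    apply intervalIntegral.integral_congr
    intro x hx
    rw [uIcc_of_le (by linarith)] at hx
    simp only [hf]
    rw [integrand_eq hx.1 hx.2]
    ring
  rw [hf4, intervalIntegral.integral_const_mul, ← hsplit, smul_eq_mul] at hscale
  have hval : ∫ x in (0 : ℝ)..(Real.pi / 2), f x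
      = Real.pi / 8 * ((mellin mellinKernel 1).re + 1 / 2) := by linarith
  have hpi0 : (Real.pi : ℂ) ≠ 0 := by exact_mod_cast hpi.ne'
  have hlog : Complex.log (2 * Real.pi) = ((Real.log (2 * Real.pi) : ℝ) : ℂ) := by
    rw [Complex.ofReal_log (by positivity)]; push_cast; rfl
  rw [hval]
  push_cast
  rw [ofReal_re_mellin_mellinKernel_one, mellin_mellinKernel_one, hlog]
  field_simp
  ring
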